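/- For complex $n\times n$ matrices $A,B$ let $$\eta(A,B)=\sum_{S\subseteq\{1,\dots,n\}}\det(A[S])\,\det(B[S']),$$ where $S'$ is the complement of $S$, $A[S]$ is the principal submatrix of $A$ with rows and columns indexed by $S$, and the determinant of an empty matrix is $1$; for matrices over $\mathbb{C}[z]$ the same formula is used. Call a nonzero univariate polynomial with real coefficients hyperbolic if all its complex zeros are real, and for such a polynomial $p$ let $\iota(p)=(\iota_+(p),\iota_0(p),\iota_-(p))$ be the numbers of its positive, zero and negative roots, counted with multiplicity. Let $A$ and $B$ be Hermitian $n\times n$ matrices with $A$ positive definite. Then the polynomial $\eta(zA,-B)$ is hyperbolic, and $$\iota(\eta(zA,-B))=\iota(\eta(zI,-B)),\qquad \eta(zI,-B)=\det(zI-B).$$ Hence $\iota(\eta(zA,-B))$ is the inertia of $B$, i.e. the triple of the numbers of positive, zero and negative eigenvalues of $B$, counted with multiplicity. In particular, the number $\iota_0(\eta(zA,-B))$ of zero roots equals the nullity $\dim\ker B$. -/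

import Mathlib

open scoped Polynomial ComplexOrder

namespace MixedDet

/-- The principal submatrix `A[S]`, with rows and columns indexed by `S`. -/
def principal {ι R : Type*} (A : Matrix ι ι R) (S : Finset ι) : Matrix S S R :=
  A.submatrix (fun i : S => (i : ι)) (fun i : S => (i : ι))

/-- The mixed determinant `η(A, B) = ∑_S det A[S] * det B[S']`, over all subsets `S` of the
index set, `S'` being the complement of `S`.  The determinant of an empty matrix is `1`. -/
def eta {ι R : Type*} [Fintype ι] [DecidableEq ι] [CommRing R] (A B : Matrix ι ι R) : R :=
  ∑ S : Finset ι, (principal A S).det * (principal B Sᶜ).det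

/-- The polynomial `η(zA, -B)` in the variable `z`. -/
noncomputable def etaPoly {ι : Type*} [Fintype ι] [DecidableEq ι] (A B : Matrix ι ι ℂ) : ℂ[X] :=
  eta ((Polynomial.X : ℂ[X]) • A.map (fun a => Polynomial.C a)) (-B.map (fun b => Polynomial.C b))

/-- A univariate polynomial is hyperbolic if it is nonzero, has real coefficients, and all of its
complex zeros are real. -/
def IsHyperbolic (p : ℂ[X]) : Prop :=
  p ≠ 0 ∧ (∀ k : ℕ, (p.coeff k).im = 0) ∧ ∀ z : ℂ, p.IsRoot z → z.im = 0

open Classical in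
/-- The inertia `(ι₊(p), ι₀(p), ι₋(p))` of a polynomial: the numbers of its positive, zero and
negative (real) roots, counted with multiplicity. -/
noncomputable def polyInertia (p : ℂ[X]) : ℕ × ℕ × ℕ :=
  (p.roots.countP (fun z => z.im = 0 ∧ 0 < z.re),
   p.roots.countP (fun z => z = 0),
   p.roots.countP (fun z => z.im = 0 ∧ z.re < 0))

open Classical in
/-- The inertia of a Hermitian matrix: the numbers of its positive, zero and negative eigenvalues,
counted with multiplicity. -/
noncomputable def matrixInertia {ι : Type*} [Fintype ι] [DecidableEq ι] {B : Matrix ι ι ℂ}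
    (hB : B.IsHermitian) : ℕ × ℕ × ℕ :=
  (Fintype.card {i : ι // 0 < hB.eigenvalues i},
   Fintype.card {i : ι // hB.eigenvalues i = 0},
   Fintype.card {i : ι // hB.eigenvalues i < 0})

end MixedDet

/-! Expanding in minors, `η(zA, -B) = ∑ (-1)^|S| det (zA)[S'] det B[S]` pairs the coefficients of
two multi-affine determinantal forms, `pencil 1 (zA)` and `pencil B 1`. For `Im z > 0` the first has
no zeros with all variables in `Im ≥ -δ` (infinity included), because `A ≥ ε > 0`; the second has
none in the open upper half plane, because `B` is Hermitian. Asano contraction, one variable at a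
time (`sum_contraction_ne_zero`), gives `η(zA, -B) ≠ 0`; conjugation symmetry then makes every zero
real.

For the inertia, deform `A` to `I` linearly through positive definite matrices. The leading
coefficient `det A` never vanishes, and the multiplicity of the root 0 stays `n - rank B`
(`rootMultiplicity_etaPoly`): the principal minors of `B` of order `rank B` never have opposite
signs and are not all zero. Real roots vary continuously and cannot cross 0, so the inertia is
constant (`polyInertia_eq_of_path`). At `A = I` the polynomial is the characteristic polynomial of
`B`. -/

namespace MixedDet

open ComplexConjugate

/-! ### Principal minors as determinants with mixed rows. -/

section Algebra

variable {ι R : Type*} [Fintype ι] [DecidableEq ι] [CommRing R]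

/-- The matrix whose rows are those of `N` on `S` and those of `M` outside `S`. -/
def mixRows (S : Finset ι) (N M : Matrix ι ι R) : Matrix ι ι R :=
  Matrix.of fun i j => if i ∈ S then N i j else M i j

/-- Replacing the rows in `S` by those of the identity leaves the complementary principal minor. -/
lemma det_mixRows_one (S : Finset ι) (M : Matrix ι ι R) :
    (mixRows S 1 M).det = (principal M Sᶜ).det := by
  have h := Matrix.twoBlockTriangular_det (mixRows S 1 M)
    (fun i => i ∈ Sᶜ) (by
      intro i hi j hj
      have hi' : i ∈ S := by simpa using hi
      have hij : i ≠ j := by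
        rintro rfl
        exact hi hj
      simp [mixRows, hi', Matrix.one_apply_ne hij])
  have h1 : Matrix.toSquareBlockProp (mixRows S 1 M) (fun i => i ∈ Sᶜ) = principal M Sᶜ := by
    ext i j
    have hi : (i : ι) ∉ S := Finset.mem_compl.1 i.2
    simp [Matrix.toSquareBlockProp, Matrix.toBlock, mixRows, principal, hi]
  have h2 : Matrix.toSquareBlockProp (mixRows S 1 M) (fun i => ¬ i ∈ Sᶜ) = 1 := by
    ext i j
    have hi : (i : ι) ∈ S := by simpa using i.2
    simp [Matrix.toSquareBlockProp, Matrix.toBlock, mixRows, hi, Matrix.one_apply,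
      Subtype.ext_iff]
  rw [h, h1, h2, Matrix.det_one, mul_one]
  congr!

lemma det_mixRows_one_right (S : Finset ι) (M : Matrix ι ι R) :
    (mixRows S M 1).det = (principal M S).det := by
  have h := det_mixRows_one Sᶜ M
  rw [compl_compl] at h
  rw [← h]
  congr 1
  ext i j
  by_cases hi : i ∈ S <;> simp [mixRows, hi]

/-- Multilinearity of the determinant in its rows expands the right side over the set `S` of rows
taken from `c • 1`. -/
lemma eta_one (B : Matrix ι ι R) (c : R) : eta (c • (1 : Matrix ι ι R)) B = (c • 1 + B).det := by
  have h := (Matrix.detRowAlternating (n := ι) (R := R)).toMultilinearMap.map_add_univ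
    (c • (1 : Matrix ι ι R)) B
  refine Eq.trans ?_ h.symm
  refine Finset.sum_congr rfl fun S _ => ?_
  have h1 : mixRows S (c • (1 : Matrix ι ι R)) B =
      Matrix.diagonal (fun i => if i ∈ S then c else 1) * mixRows S 1 B := by
    ext i j
    by_cases hi : i ∈ S <;> simp [mixRows, hi]
  have h2 : principal (c • (1 : Matrix ι ι R)) S = c • (1 : Matrix S S R) := by
    ext i j
    simp only [principal, Matrix.submatrix_apply, Matrix.smul_apply, Matrix.one_apply,
      SetLike.coe_eq_coe]
  have h3 : (mixRows S (c • (1 : Matrix ι ι R)) B).det = c ^ S.card * (principal B Sᶜ).det := by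
    rw [h1, Matrix.det_mul, Matrix.det_diagonal, det_mixRows_one, Finset.prod_ite_mem,
      Finset.univ_inter, Finset.prod_const]
  rw [h2, Matrix.det_smul, Matrix.det_one, mul_one, Fintype.card_coe, ← h3]
  congr 1
  funext i j
  by_cases hi : i ∈ S <;> simp [mixRows, Finset.piecewise, hi]

end Algebra

/-! ### Coefficients and values of `etaPoly`. -/

section EtaPoly

variable {ι : Type*} [Fintype ι] [DecidableEq ι]

lemma etaPoly_one (B : Matrix ι ι ℂ) : etaPoly 1 B = B.charpoly := by
  have h := eta_one (-B.map (fun b => Polynomial.C b)) (Polynomial.X : ℂ[X])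
  rw [etaPoly, show (1 : Matrix ι ι ℂ).map (fun a => Polynomial.C a) = 1 from
    Matrix.map_one _ Polynomial.C_0 Polynomial.C_1, h, Matrix.charpoly, Matrix.charmatrix,
    ← sub_eq_add_neg]
  congr 2
  ext1 i j
  simp [Matrix.one_apply, Matrix.diagonal_apply]

lemma etaPoly_eq_sum (A B : Matrix ι ι ℂ) :
    etaPoly A B = ∑ S : Finset ι,
      Polynomial.C ((principal A S).det * (principal (-B) Sᶜ).det) * Polynomial.X ^ S.card := by
  refine Finset.sum_congr rfl fun S _ => ?_
  have h1 : principal ((Polynomial.X : ℂ[X]) • A.map (fun a => Polynomial.C a)) S =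
      (Polynomial.X : ℂ[X]) • (Polynomial.C : ℂ →+* ℂ[X]).mapMatrix (principal A S) := rfl
  have h2 : principal (-B.map (fun b => (Polynomial.C b : ℂ[X]))) Sᶜ =
      (Polynomial.C : ℂ →+* ℂ[X]).mapMatrix (principal (-B) Sᶜ) := by
    ext1 i j
    simp [principal]
  rw [h1, h2, Matrix.det_smul, ← RingHom.map_det, ← RingHom.map_det, Polynomial.C_mul,
    Fintype.card_coe]
  ring

lemma coeff_etaPoly (A B : Matrix ι ι ℂ) (k : ℕ) :
    (etaPoly A B).coeff k = ∑ S : Finset ι with S.card = k,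
      (principal A S).det * (principal (-B) Sᶜ).det := by
  rw [etaPoly_eq_sum, Polynomial.finsetSum_coeff, Finset.sum_filter]
  refine Finset.sum_congr rfl fun S _ => ?_
  rw [Polynomial.coeff_C_mul_X_pow]
  simp [eq_comm]

lemma eval_etaPoly (A B : Matrix ι ι ℂ) (z : ℂ) :
    (etaPoly A B).eval z = eta (z • A) (-B) := by
  rw [etaPoly_eq_sum, Polynomial.eval_finsetSum]
  refine Finset.sum_congr rfl fun S _ => ?_
  have h1 : principal (z • A) S = z • principal A S := rfl
  rw [h1, Matrix.det_smul, Fintype.card_coe]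
  simp only [Polynomial.eval_mul, Polynomial.eval_C, Polynomial.eval_pow, Polynomial.eval_X]
  ring

lemma coeff_etaPoly_card (A B : Matrix ι ι ℂ) :
    (etaPoly A B).coeff (Fintype.card ι) = A.det := by
  have h : (Finset.univ.filter fun S : Finset ι => S.card = Fintype.card ι) = {Finset.univ} := by
    ext S
    simp [Finset.card_eq_iff_eq_univ]
  have h0 := det_mixRows_one_right Finset.univ A
  have h1 : mixRows Finset.univ A 1 = A := by ext; simp [mixRows]
  rw [h1] at h0
  have : IsEmpty ((Finset.univ : Finset ι)ᶜ : Finset ι) :=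
    ⟨fun i => by simpa using i.2⟩
  rw [coeff_etaPoly, h, Finset.sum_singleton, ← h0, Matrix.det_isEmpty (A := principal (-B) _),
    mul_one]

lemma natDegree_etaPoly_le (A B : Matrix ι ι ℂ) :
    (etaPoly A B).natDegree ≤ Fintype.card ι := by
  rw [etaPoly_eq_sum]
  refine Polynomial.natDegree_sum_le_of_forall_le _ _ fun S _ => ?_
  exact (Polynomial.natDegree_C_mul_X_pow_le _ _).trans (Finset.card_le_univ S)

end EtaPoly

/-! ### Constancy of the inertia along paths of real-rooted polynomials. -/

lemma exists_fin_enumeration {α : Type*} {n : ℕ} (s : Multiset α) (h : s.card = n) :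
    ∃ f : Fin n → α, Finset.univ.val.map f = s := by
  obtain ⟨l, rfl⟩ : ∃ l : List α, (l : Multiset α) = s := ⟨s.toList, s.coe_toList⟩
  rw [Multiset.coe_card] at h
  subst h
  refine ⟨l.get, ?_⟩
  rw [Fin.univ_val_map, List.ofFn_get]

/-- The numbers of positive, zero and negative entries of a sign vector. -/
def signCount {n : ℕ} (σ : Fin n → SignType) : ℕ × ℕ × ℕ :=
  ((Finset.univ.filter fun i => σ i = 1).card, (Finset.univ.filter fun i => σ i = 0).card,
    (Finset.univ.filter fun i => σ i = -1).card)

lemma polyInertia_eq_signCount {n : ℕ} {p : ℂ[X]} {r : Fin n → ℝ}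
    (h : p.roots = Finset.univ.val.map fun i => (r i : ℂ)) :
    polyInertia p = signCount fun i => SignType.sign (r i) := by
  unfold polyInertia signCount
  rw [h]
  simp only [Multiset.countP_map, Complex.ofReal_im, Complex.ofReal_re, true_and,
    Complex.ofReal_eq_zero, sign_eq_one_iff, sign_eq_zero_iff, sign_eq_neg_one_iff]
  rfl

lemma roots_eq_of_eval_eq_prod {n : ℕ} {p : ℂ[X]} {a : ℂ} (ha : a ≠ 0) {r : Fin n → ℝ}
    (h : ∀ z, p.eval z = a * ∏ i, (z - r i)) :
    p.roots = Finset.univ.val.map fun i => (r i : ℂ) := by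
  have h1 : p = Polynomial.C a * ∏ i, (Polynomial.X - Polynomial.C (r i : ℂ)) := by
    refine Polynomial.funext fun z => ?_
    rw [h z, Polynomial.eval_mul, Polynomial.eval_C, Polynomial.eval_prod]
    simp
  rw [h1, Polynomial.roots_C_mul _ ha, Polynomial.roots_prod _ _
    (Finset.prod_ne_zero_iff.2 fun i _ => Polynomial.X_sub_C_ne_zero _)]
  simp

lemma exists_real_factorization {n : ℕ} {p : ℂ[X]} (hdeg : p.natDegree ≤ n)
    (hn : p.coeff n ≠ 0) (hreal : ∀ z, p.IsRoot z → z.im = 0) :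
    ∃ r : Fin n → ℝ, (∀ i, p.IsRoot (r i)) ∧
      ∀ z, p.eval z = p.coeff n * ∏ i, (z - r i) := by
  have hd : p.natDegree = n := le_antisymm hdeg (Polynomial.le_natDegree_of_ne_zero hn)
  have hp : p ≠ 0 := fun h => hn (by simp [h])
  have hsplit : p.Splits := IsAlgClosed.splits p
  obtain ⟨f, hf⟩ := exists_fin_enumeration p.roots (hsplit.natDegree_eq_card_roots.symm.trans hd)
  have hroot : ∀ i, p.IsRoot (f i) := fun i => Polynomial.isRoot_of_mem_roots (by
    rw [← hf]
    exact Multiset.mem_map_of_mem f (Finset.mem_univ i))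
  have hre : ∀ i, (((f i).re : ℝ) : ℂ) = f i := fun i =>
    Complex.ext (by simp) (by simp [hreal _ (hroot i)])
  refine ⟨fun i => (f i).re, fun i => by rw [hre]; exact hroot i, fun z => ?_⟩
  simp only [hre]
  conv_lhs => rw [hsplit.eq_prod_roots]
  rw [← hf, Polynomial.leadingCoeff, hd, Multiset.map_map, Polynomial.eval_mul,
    Polynomial.eval_C, Polynomial.eval_multiset_prod, Multiset.map_map]
  congr 1
  change (Finset.univ.val.map _).prod = (Finset.univ.val.map _).prod
  simp

lemma exists_root_bound {n : ℕ} {p : ℝ → ℂ[X]} (hdeg : ∀ t, (p t).natDegree ≤ n)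
    (hcont : ∀ k, Continuous fun t => (p t).coeff k)
    (hn : ∀ t ∈ Set.Icc (0 : ℝ) 1, (p t).coeff n ≠ 0) :
    ∃ R : ℝ, ∀ t ∈ Set.Icc (0 : ℝ) 1, ∀ z, (p t).IsRoot z → ‖z‖ ≤ R := by
  have hc : ContinuousOn (fun t => (∑ k ∈ Finset.range n, ‖(p t).coeff k‖) / ‖(p t).coeff n‖ + 1)
      (Set.Icc (0 : ℝ) 1) := by
    refine ContinuousOn.add (ContinuousOn.div ?_ ?_ fun t ht => norm_ne_zero_iff.2 (hn t ht))
      continuousOn_const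
    · exact (continuous_finsetSum _ fun k _ => (hcont k).norm).continuousOn
    · exact (hcont n).norm.continuousOn
  obtain ⟨R, hR⟩ := isCompact_Icc.exists_bound_of_continuousOn hc
  refine ⟨R, fun t ht z hz => ?_⟩
  have hd : (p t).natDegree = n :=
    le_antisymm (hdeg t) (Polynomial.le_natDegree_of_ne_zero (hn t ht))
  have h1 := Polynomial.IsRoot.norm_lt_cauchyBound (fun h => hn t ht (by simp [h])) hz
  -- The supremum in Cauchy's bound is weakened to a sum, which is visibly continuous in `t`.
  have h2 : (p t).cauchyBound ≤
      (∑ k ∈ Finset.range n, ‖(p t).coeff k‖₊) / ‖(p t).coeff n‖₊ + 1 := by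
    rw [Polynomial.cauchyBound, Polynomial.leadingCoeff, hd]
    gcongr
    exact Finset.sup_le fun k hk =>
      Finset.single_le_sum (f := fun k => ‖(p t).coeff k‖₊) (fun _ _ => zero_le) hk
  have h3 : ‖z‖ ≤ (∑ k ∈ Finset.range n, ‖(p t).coeff k‖) / ‖(p t).coeff n‖ + 1 := by
    have h := NNReal.coe_le_coe.2 (h1.le.trans h2)
    push_cast [coe_nnnorm] at h
    exact h
  exact h3.trans ((le_abs_self _).trans (hR t ht))

/-- Weak sign conditions are closed but let an entry degenerate to zero; equal numbers of zeros rule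
this out. -/
lemma sign_eq_of_card_eq {n : ℕ} {σ : Fin n → SignType} {r : Fin n → ℝ}
    (h : ∀ i, 0 ≤ (σ i : ℝ) * r i ∧ (σ i = 0 → r i = 0))
    (hcard : (Finset.univ.filter fun i => σ i = 0).card =
      (Finset.univ.filter fun i => r i = 0).card) (i : Fin n) :
    SignType.sign (r i) = σ i := by
  have hsub : (Finset.univ.filter fun i => σ i = 0) ⊆ Finset.univ.filter fun i => r i = 0 := by
    intro j hj
    simp only [Finset.mem_filter, Finset.mem_univ, true_and] at hj ⊢
    exact (h j).2 hj
  have heq := Finset.eq_of_subset_of_card_le hsub hcard.ge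
  have hiff : σ i = 0 ↔ r i = 0 := by
    have := Finset.ext_iff.1 heq i
    simpa using this
  obtain ⟨h1, h2⟩ := h i
  rcases hσ : σ i with _ | _ | _
  · simpa using h2 hσ
  · have hne : r i ≠ 0 := fun h0 => by simp [hiff.2 h0] at hσ
    have : r i ≤ 0 := by simpa [hσ] using h1
    exact sign_eq_neg_one_iff.2 (lt_of_le_of_ne this hne)
  · have hne : r i ≠ 0 := fun h0 => by simp [hiff.2 h0] at hσ
    have : 0 ≤ r i := by simpa [hσ] using h1
    exact sign_eq_one_iff.2 (lt_of_le_of_ne this hne.symm)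

/-- Along a continuous path of real-rooted polynomials of constant degree, with constant
multiplicity of the root zero, the inertia is constant. -/
theorem polyInertia_eq_of_path {n m : ℕ} {p : ℝ → ℂ[X]} (hdeg : ∀ t, (p t).natDegree ≤ n)
    (hcont : ∀ k, Continuous fun t => (p t).coeff k)
    (hn : ∀ t ∈ Set.Icc (0 : ℝ) 1, (p t).coeff n ≠ 0)
    (hreal : ∀ t ∈ Set.Icc (0 : ℝ) 1, ∀ z, (p t).IsRoot z → z.im = 0)
    (hzero : ∀ t ∈ Set.Icc (0 : ℝ) 1, (p t).rootMultiplicity 0 = m) :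
    polyInertia (p 0) = polyInertia (p 1) := by
  obtain ⟨R, hR⟩ := exists_root_bound hdeg hcont hn
  have heval : ∀ z, Continuous fun t => (p t).eval z := by
    intro z
    have : (fun t => (p t).eval z) = fun t => ∑ k ∈ Finset.range (n + 1), (p t).coeff k * z ^ k :=
      funext fun t => Polynomial.eval_eq_sum_range' (Nat.lt_succ_of_le (hdeg t)) z
    rw [this]
    exact continuous_finsetSum _ fun k _ => (hcont k).mul continuous_const
  -- `F` collects the parameters with an ordered root vector, `G σ` imposes the weak sign pattern
  -- `σ`, and `K` is a compact box containing all the roots.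
  set F : Set (ℝ × (Fin n → ℝ)) :=
    {x | ∀ z : ℂ, (p x.1).eval z = (p x.1).coeff n * ∏ i, (z - x.2 i)} with hF
  set G : (Fin n → SignType) → Set (ℝ × (Fin n → ℝ)) := fun σ =>
    {x | ∀ i, 0 ≤ (σ i : ℝ) * x.2 i ∧ (σ i = 0 → x.2 i = 0)} with hG
  set K : Set (ℝ × (Fin n → ℝ)) :=
    Set.Icc 0 1 ×ˢ Set.Icc (fun _ => -R) (fun _ => R) with hK
  have hFc : IsClosed F := by
    simp only [hF, Set.ofPred_forall]
    refine isClosed_iInter fun z => isClosed_eq ((heval z).comp continuous_fst) ?_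
    refine ((hcont n).comp continuous_fst).mul (continuous_finsetProd _ fun i _ => ?_)
    exact continuous_const.sub (Complex.continuous_ofReal.comp
      ((continuous_apply i).comp continuous_snd))
  have hGc : ∀ σ, IsClosed (G σ) := by
    intro σ
    simp only [hG, Set.ofPred_forall, Set.ofPred_and]
    refine isClosed_iInter fun i => IsClosed.inter ?_ (isClosed_iInter fun _ => ?_)
    · exact isClosed_le continuous_const (by fun_prop)
    · exact isClosed_eq (by fun_prop) continuous_const
  have hKc : IsCompact K := isCompact_Icc.prod isCompact_Icc
  have himg : ∀ σ, IsClosed (Prod.fst '' (K ∩ (F ∩ G σ))) := fun σ =>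
    ((hKc.inter_right (hFc.inter (hGc σ))).image continuous_fst).isClosed
  have hinertia : ∀ (t : ℝ) (r : Fin n → ℝ), t ∈ Set.Icc (0 : ℝ) 1 → (t, r) ∈ F →
      polyInertia (p t) = signCount (fun i => SignType.sign (r i)) ∧
        (Finset.univ.filter fun i => r i = 0).card = m := by
    intro t r ht hr
    have hroots := roots_eq_of_eval_eq_prod (hn t ht) hr
    refine ⟨polyInertia_eq_signCount hroots, ?_⟩
    rw [← hzero t ht, ← Polynomial.count_roots, hroots, Multiset.count_map]
    simp only [Finset.card_def, Finset.filter_val]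
    congr 1
    refine Multiset.filter_congr fun i _ => ?_
    rw [eq_comm (a := (0 : ℂ)), Complex.ofReal_eq_zero]
  have hg : Continuous fun t : Set.Icc (0 : ℝ) 1 => polyInertia (p t) := by
    rw [continuous_iff_isClosed]
    intro V _
    -- Every preimage is a finite union of projections of compact sets, hence closed; so the inertia
    -- is a continuous map into a discrete space.
    have hpre : (fun t : Set.Icc (0 : ℝ) 1 => polyInertia (p t)) ⁻¹' V =
        ⋃ σ : {σ : Fin n → SignType // signCount σ ∈ V ∧
          (Finset.univ.filter fun i => σ i = 0).card = m},
          Subtype.val ⁻¹' (Prod.fst '' (K ∩ (F ∩ G σ.1))) := by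
      ext t
      simp only [Set.mem_preimage, Set.mem_iUnion]
      constructor
      · intro ht
        obtain ⟨r, hr, hfac⟩ := exists_real_factorization (hdeg t) (hn t t.2) (hreal t t.2)
        obtain ⟨h1, h2⟩ := hinertia t r t.2 hfac
        refine ⟨⟨fun i => SignType.sign (r i), by rwa [← h1], ?_⟩, (t, r),
          ⟨⟨t.2, ?_⟩, hfac, ?_⟩, rfl⟩
        · simpa using h2
        · have hb : ∀ i, |r i| ≤ R := fun i => by simpa using hR t t.2 _ (hr i)
          exact ⟨fun i => (abs_le.1 (hb i)).1, fun i => (abs_le.1 (hb i)).2⟩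
        · intro i
          refine ⟨?_, fun h => sign_eq_zero_iff.1 h⟩
          rw [sign_mul_self]
          exact abs_nonneg _
      · rintro ⟨⟨σ, hσ, hσm⟩, ⟨t', r⟩, ⟨-, hfac, hsign⟩, rfl⟩
        obtain ⟨h1, h2⟩ := hinertia t r t.2 hfac
        have h3 : (fun i => SignType.sign (r i)) = σ :=
          funext fun i => sign_eq_of_card_eq hsign (hσm.trans h2.symm) i
        rwa [h1, h3]
    rw [hpre]
    exact isClosed_iUnion_of_finite fun σ => (himg σ.1).preimage continuous_subtype_val
  have : PreconnectedSpace (Set.Icc (0 : ℝ) 1) := Subtype.preconnectedSpace isPreconnected_Icc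
  exact PreconnectedSpace.constant this hg (x := ⟨0, by simp⟩) (y := ⟨1, by simp⟩)

/-! ### Asano contraction. -/

/-- The points of the projective line (in homogeneous coordinates) with imaginary part `≥ -δ`,
including the point at infinity. -/
def halfPlane (δ : ℝ) : Set (ℂ × ℂ) :=
  {u | u ≠ 0 ∧ -(δ * Complex.normSq u.2) ≤ (u.1 * conj u.2).im}

/-- Asano contraction of a pair of variables. -/
lemma contraction_ne_zero {δ : ℝ} (hδ : 0 < δ) {a b c d : ℂ}
    (h : ∀ u ∈ halfPlane δ, ∀ y : ℂ, 0 < y.im →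
      u.2 * a + u.1 * b + (u.2 * c + u.1 * d) * y ≠ 0) : a - d ≠ 0 := by
  intro had
  obtain rfl : a = d := sub_eq_zero.1 had
  -- The slack `δ` lets `x = -iδ` be admissible in the first variable while `x⁻¹ = i/δ` is
  -- admissible in the second. If `a = d`, the zero `y₀` in the second variable over `x` is the
  -- inverse of the zero in the first variable over `x⁻¹`. Either `1/y₀`, possibly infinite, is in
  -- the closed region, or its imaginary part is negative and `Im y₀ > 0`; both give a forbidden
  -- zero.
  set x : ℂ := ⟨0, -δ⟩ with hx
  have hx0 : x ≠ 0 := fun h0 => by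
    have := congrArg Complex.im h0
    simp [hx] at this
    exact hδ.ne' this
  have hxmem : ((x, 1) : ℂ × ℂ) ∈ halfPlane δ := by
    refine ⟨by simp, ?_⟩
    simp [hx]
  have hyinv : 0 < (x⁻¹).im := by
    rw [Complex.inv_im]
    have : 0 < Complex.normSq x := Complex.normSq_pos.2 hx0
    have : 0 < -x.im := by simpa [hx] using hδ
    positivity
  by_cases hdeg : (c + a * x = 0 ∧ a + b * x = 0)
  · refine h _ hxmem Complex.I (by simp) ?_
    linear_combination hdeg.1 * Complex.I + hdeg.2
  by_cases hmem : ((c + a * x, -(a + b * x)) : ℂ × ℂ) ∈ halfPlane δ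
  · refine h _ hmem x⁻¹ hyinv ?_
    simp only
    field_simp
    ring
  · have hlt : ((c + a * x) * conj (-(a + b * x))).im < 0 := by
      by_contra hcon
      refine hmem ⟨fun h0 => hdeg ?_, ?_⟩
      · simpa [Prod.ext_iff, -neg_add_rev] using h0
      · refine le_trans ?_ (not_lt.1 hcon)
        have := Complex.normSq_nonneg (-(a + b * x))
        simp only
        nlinarith
    have hne : c + a * x ≠ 0 := fun h0 => by simp [h0] at hlt
    refine h _ hxmem (-(a + b * x) / (c + a * x)) ?_ ?_
    · have h1 : (-(a + b * x)) / (c + a * x) =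
          ((Complex.normSq (c + a * x))⁻¹ : ℝ) * conj ((c + a * x) * conj (-(a + b * x))) := by
        rw [map_mul, Complex.conj_conj, div_eq_mul_inv, Complex.inv_def]
        push_cast
        ring
      rw [h1, Complex.im_ofReal_mul, Complex.conj_im]
      have : 0 < Complex.normSq (c + a * x) := Complex.normSq_pos.2 hne
      have := neg_pos.2 hlt
      positivity
    · simp only
      field_simp
      ring

variable {ι : Type*} [Fintype ι] [DecidableEq ι]

/-- Contraction of all variables of a pair of multilinear forms that do not vanish on products
of half planes. -/
lemma sum_contraction_ne_zero {δ : ℝ} (hδ : 0 < δ)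
    (P Q : MultilinearMap ℂ (fun _ : ι => ℂ × ℂ) ℂ)
    (hP : ∀ u : ι → ℂ × ℂ, (∀ i, u i ∈ halfPlane δ) → P u ≠ 0)
    (hQ : ∀ y : ι → ℂ, (∀ i, 0 < (y i).im) → Q (fun i => (y i, 1)) ≠ 0) :
    ∑ S : Finset ι, (-1 : ℂ) ^ S.card * (P (S.piecewise (fun _ => (1, 0)) (fun _ => (0, 1))) *
      Q (S.piecewise (fun _ => (1, 0)) (fun _ => (0, 1)))) ≠ 0 := by
  -- Induction on the set `J` of slots already contracted; the other slots stay free in their half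
  -- planes.
  have key : ∀ J : Finset ι, ∀ u : ι → ℂ × ℂ, (∀ i, u i ∈ halfPlane δ) →
      ∀ y : ι → ℂ, (∀ i, 0 < (y i).im) →
      ∑ S ∈ J.powerset, (-1 : ℂ) ^ S.card *
        (P (J.piecewise (S.piecewise (fun _ => (1, 0)) (fun _ => (0, 1))) u) *
        Q (J.piecewise (S.piecewise (fun _ => (1, 0)) (fun _ => (0, 1)))
          (fun i => (y i, 1)))) ≠ 0 := by
    intro J
    induction J using Finset.induction_on with
    | empty =>
      intro u hu y hy
      simpa using ⟨hP u hu, hQ y hy⟩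
    | insert j J hj ih =>
      intro u hu y hy
      set e : Finset ι → ι → ℂ × ℂ :=
        fun S => S.piecewise (fun _ => (1, 0)) (fun _ => (0, 1)) with he
      set F : ℂ × ℂ → ℂ × ℂ → ℂ := fun s t => ∑ S ∈ J.powerset, (-1 : ℂ) ^ S.card *
        (P (Function.update (J.piecewise (e S) u) j s) *
          Q (Function.update (J.piecewise (e S) (fun i => (y i, 1))) j t)) with hF
      have hlin : ∀ (T : MultilinearMap ℂ (fun _ : ι => ℂ × ℂ) ℂ) (m : ι → ℂ × ℂ) (s : ℂ × ℂ),
          T (Function.update m j s) =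
            s.1 * T (Function.update m j (1, 0)) + s.2 * T (Function.update m j (0, 1)) := by
        intro T m s
        conv_lhs => rw [show s = s.1 • ((1, 0) : ℂ × ℂ) + s.2 • ((0, 1) : ℂ × ℂ) by
          ext <;> simp]
        rw [T.map_update_add, T.map_update_smul, T.map_update_smul, smul_eq_mul, smul_eq_mul]
      have hFlin : ∀ s : ℂ × ℂ, ∀ w : ℂ, F s (w, 1) =
          s.2 * F (0, 1) (0, 1) + s.1 * F (1, 0) (0, 1) +
            (s.2 * F (0, 1) (1, 0) + s.1 * F (1, 0) (1, 0)) * w := by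
        intro s w
        simp only [hF, Finset.mul_sum, Finset.sum_mul, ← Finset.sum_add_distrib]
        refine Finset.sum_congr rfl fun S _ => ?_
        rw [hlin P _ s, hlin Q _ (w, 1)]
        ring
      have hmain : F (0, 1) (0, 1) - F (1, 0) (1, 0) ≠ 0 := by
        refine contraction_ne_zero hδ (b := F (1, 0) (0, 1)) (c := F (0, 1) (1, 0)) ?_
        intro s hs w hw
        rw [← hFlin]
        have h := ih (Function.update u j s)
          (fun i => by by_cases hi : i = j
                       · subst hi; simpa using hs
                       · simpa [hi] using hu i)
          (Function.update y j w)
          (fun i => by by_cases hi : i = j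
                       · subst hi; simpa using hw
                       · simpa [hi] using hy i)
        have hy' : (fun i => ((Function.update y j w i, 1) : ℂ × ℂ)) =
            Function.update (fun i => (y i, 1)) j (w, 1) := by
          funext i
          by_cases hi : i = j
          · subst hi; simp
          · simp [hi]
        rw [hy'] at h
        simpa only [hF, Finset.update_piecewise_of_notMem _ _ _ hj] using h
      convert hmain using 1
      -- Subsets without `j` give the coefficient `a`; those with `j` give `-d`, the extra factor
      -- `-1` coming from the cardinality.
      rw [Finset.sum_powerset_insert hj, sub_eq_add_neg]
      have hins : ∀ S ∈ J.powerset, ∀ v : ι → ℂ × ℂ,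
          (insert j J).piecewise (e S) v = Function.update (J.piecewise (e S) v) j (0, 1) := by
        intro S hS v
        have hjS : j ∉ S := fun h => hj (Finset.mem_powerset.1 hS h)
        rw [Finset.piecewise_insert]
        simp [he, hjS]
      have hins' : ∀ S ∈ J.powerset, ∀ v : ι → ℂ × ℂ,
          (insert j J).piecewise (e (insert j S)) v =
            Function.update (J.piecewise (e S) v) j (1, 0) := by
        intro S hS v
        rw [Finset.piecewise_insert]
        have : e (insert j S) j = (1, 0) := by simp [he]
        rw [this, Finset.update_piecewise_of_notMem _ _ _ hj,
          Finset.update_piecewise_of_notMem _ _ _ hj]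
        refine J.piecewise_congr (fun i hi => ?_) fun _ _ => rfl
        have hij : i ≠ j := fun h => hj (h ▸ hi)
        simp [he, Finset.piecewise, hij]
      congr 1
      · refine Finset.sum_congr rfl fun S hS => ?_
        rw [hins S hS, hins S hS]
      · rw [hF, ← Finset.sum_neg_distrib]
        refine Finset.sum_congr rfl fun S hS => ?_
        have hjS : j ∉ S := fun h => hj (Finset.mem_powerset.1 hS h)
        rw [hins' S hS, hins' S hS, Finset.card_insert_of_notMem hjS, pow_succ]
        ring
  -- All slots are contracted, so the values of `u` and `y` are immaterial.
  have h := key Finset.univ (fun _ => (Complex.I, 1)) (fun _ => ⟨by simp, by simp; linarith⟩)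
    (fun _ => Complex.I) (fun _ => by simp)
  simpa using h

/-! ### Zero-free regions of the two pencils, and hyperbolicity. -/

/-- The multilinear form `u ↦ det (diag(s) N + diag(t) M)`, where `u i = (s i, t i)`. -/
noncomputable def pencil (N M : Matrix ι ι ℂ) : MultilinearMap ℂ (fun _ : ι => ℂ × ℂ) ℂ :=
  (Matrix.detRowAlternating (n := ι) (R := ℂ)).toMultilinearMap.compLinearMap
    (fun i => (LinearMap.fst ℂ ℂ ℂ).smulRight (N i) + (LinearMap.snd ℂ ℂ ℂ).smulRight (M i))

lemma pencil_apply (N M : Matrix ι ι ℂ) (u : ι → ℂ × ℂ) :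
    pencil N M u = (Matrix.of fun i j => (u i).1 * N i j + (u i).2 * M i j).det := rfl

lemma pencil_piecewise (N M : Matrix ι ι ℂ) (S : Finset ι) :
    pencil N M (S.piecewise (fun _ => (1, 0)) (fun _ => (0, 1))) = (mixRows S N M).det := by
  rw [pencil_apply]
  congr 1
  ext i j
  by_cases hi : i ∈ S <;> simp [mixRows, hi]

lemma exists_kernel_of_pencil_eq_zero {N M : Matrix ι ι ℂ} {u : ι → ℂ × ℂ}
    (h : pencil N M u = 0) :
    ∃ v : ι → ℂ, v ≠ 0 ∧ ∀ i, (u i).1 * (N.mulVec v) i + (u i).2 * (M.mulVec v) i = 0 := by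
  rw [pencil_apply] at h
  obtain ⟨v, hv, hv0⟩ := Matrix.exists_mulVec_eq_zero_iff.2 h
  refine ⟨v, hv, fun i => ?_⟩
  have := congrFun hv0 i
  simp only [Matrix.mulVec, dotProduct, Matrix.of_apply, Pi.zero_apply] at this ⊢
  rw [← this, Finset.mul_sum, Finset.mul_sum, ← Finset.sum_add_distrib]
  exact Finset.sum_congr rfl fun j _ => by ring

/-- A kernel vector has `s_i v_i + t_i (Mv)_i = 0`, so each term of `Im (v* M v)` is at most `δ
|v_i|²` (and zero if `t_i = 0`), contradicting `hM`. -/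
lemma pencil_one_ne_zero {δ : ℝ} {M : Matrix ι ι ℂ}
    (hM : ∀ v : ι → ℂ, v ≠ 0 → δ * ∑ i, Complex.normSq (v i) < (star v ⬝ᵥ M.mulVec v).im)
    {u : ι → ℂ × ℂ} (hu : ∀ i, u i ∈ halfPlane δ) : pencil 1 M u ≠ 0 := by
  intro h
  obtain ⟨v, hv, hv0⟩ := exists_kernel_of_pencil_eq_zero h
  refine (hM v hv).not_ge ?_
  simp only [Matrix.one_mulVec] at hv0
  rw [dotProduct, Complex.im_sum, Finset.mul_sum]
  refine Finset.sum_le_sum fun i _ => ?_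
  obtain ⟨hne, him⟩ := hu i
  set w := M.mulVec v i
  have h0 := hv0 i
  by_cases ht : (u i).2 = 0
  · have hs : (u i).1 ≠ 0 := fun hs => hne (Prod.ext hs ht)
    have : v i = 0 := by simpa [ht, hs] using h0
    simp [this]
  · have hw : w = -((u i).1 / (u i).2) * v i := by
      field_simp
      linear_combination h0
    have hdiv : (u i).1 / (u i).2 = ((Complex.normSq (u i).2)⁻¹ : ℝ) *
        ((u i).1 * conj (u i).2) := by
      rw [div_eq_mul_inv, Complex.inv_def]
      push_cast
      ring
    have hpos : 0 < Complex.normSq (u i).2 := Complex.normSq_pos.2 ht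
    have hge : -δ ≤ ((u i).1 / (u i).2).im := by
      rw [hdiv, Complex.im_ofReal_mul, inv_mul_eq_div, le_div_iff₀ hpos]
      linarith
    have heq : star v i * w = -((u i).1 / (u i).2) * (Complex.normSq (v i) : ℂ) := by
      rw [hw, ← Complex.mul_conj, Pi.star_apply, Complex.star_def]
      ring
    rw [heq, Complex.im_mul_ofReal, Complex.neg_im]
    exact mul_le_mul_of_nonneg_right (by linarith) (Complex.normSq_nonneg _)

/-- A kernel vector has `v_i = -y_i (Bv)_i`, so `0 = Im (v* B v) = ∑ Im y_i |(Bv)_i|²`; thus `Bv =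
0` and then `v = 0`. -/
lemma pencil_hermitian_ne_zero {B : Matrix ι ι ℂ} (hB : B.IsHermitian)
    {y : ι → ℂ} (hy : ∀ i, 0 < (y i).im) : pencil B 1 (fun i => (y i, 1)) ≠ 0 := by
  intro h
  obtain ⟨v, hv, hv0⟩ := exists_kernel_of_pencil_eq_zero h
  simp only [Matrix.one_mulVec, one_mul] at hv0
  have him : (star v ⬝ᵥ B.mulVec v).im = 0 := by
    have := hB.im_star_dotProduct_mulVec_self v
    simpa using this
  have hterm : ∀ i, (star v i * B.mulVec v i).im =
      (y i).im * Complex.normSq (B.mulVec v i) := by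
    intro i
    have hvi : v i = -(y i * B.mulVec v i) := by linear_combination hv0 i
    have : star v i * B.mulVec v i = -(conj (y i)) * (Complex.normSq (B.mulVec v i) : ℂ) := by
      rw [Pi.star_apply, hvi, ← Complex.mul_conj, Complex.star_def, map_neg, map_mul]
      ring
    rw [this, Complex.im_mul_ofReal]
    simp
  rw [dotProduct, Complex.im_sum] at him
  simp only [hterm] at him
  have hz := (Finset.sum_eq_zero_iff_of_nonneg (fun i _ =>
    mul_nonneg (hy i).le (Complex.normSq_nonneg _))).1 him
  refine hv (funext fun i => ?_)
  have h1 : B.mulVec v i = 0 := by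
    have := hz i (Finset.mem_univ i)
    simpa [(hy i).ne'] using this
  simpa [h1] using hv0 i

lemma exists_pos_le_of_posDef {A : Matrix ι ι ℂ} (hA : A.PosDef) :
    ∃ ε : ℝ, 0 < ε ∧ ∀ v : ι → ℂ,
      ε * ∑ i, Complex.normSq (v i) ≤ (star v ⬝ᵥ A.mulVec v).re := by
  obtain ⟨ε, hε, hle⟩ : ∃ ε : ℝ, 0 < ε ∧ ∀ i, ε ≤ hA.1.eigenvalues i := by
    rcases isEmpty_or_nonempty ι with h | h
    · exact ⟨1, one_pos, fun i => h.elim i⟩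
    · obtain ⟨i, hi⟩ := Finite.exists_min hA.1.eigenvalues
      exact ⟨_, hA.eigenvalues_pos i, hi⟩
  refine ⟨ε, hε, fun v => ?_⟩
  have hpsd : (A - (ε : ℂ) • 1).PosSemidef := by
    have h1 : A - (ε : ℂ) • 1 = (hA.1.eigenvectorUnitary : Matrix ι ι ℂ) *
        Matrix.diagonal (fun i => ((hA.1.eigenvalues i - ε : ℝ) : ℂ)) *
        (hA.1.eigenvectorUnitary : Matrix ι ι ℂ).conjTranspose := by
      have h2 : Matrix.diagonal (fun i => ((hA.1.eigenvalues i - ε : ℝ) : ℂ)) =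
          Matrix.diagonal (RCLike.ofReal ∘ hA.1.eigenvalues) - (ε : ℂ) • 1 := by
        ext i j
        by_cases hij : i = j
        · subst hij; simp
        · simp [hij]
      have h3 : (hA.1.eigenvectorUnitary : Matrix ι ι ℂ) *
          (hA.1.eigenvectorUnitary : Matrix ι ι ℂ).conjTranspose = 1 :=
        Unitary.coe_mul_star_self _
      have h4 := hA.1.spectral_theorem
      rw [Unitary.conjStarAlgAut_apply] at h4
      rw [h2, mul_sub, sub_mul, Matrix.mul_smul, Matrix.smul_mul, mul_one, h3]
      congr 1
    rw [h1]
    refine Matrix.PosSemidef.mul_mul_conjTranspose_same ?_ _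
    refine Matrix.PosSemidef.diagonal fun i => ?_
    simpa using hle i
  have h := hpsd.re_dotProduct_nonneg v
  rw [Matrix.sub_mulVec, Matrix.smul_mulVec, Matrix.one_mulVec, dotProduct_sub,
    dotProduct_smul] at h
  have hs : star v ⬝ᵥ v = ((∑ i, Complex.normSq (v i) : ℝ) : ℂ) := by
    rw [dotProduct]
    push_cast
    refine Finset.sum_congr rfl fun i _ => ?_
    rw [← Complex.mul_conj, Pi.star_apply, Complex.star_def, mul_comm]
  rw [hs, smul_eq_mul, ← Complex.ofReal_mul, map_sub] at h
  simp only [RCLike.re_to_complex, Complex.ofReal_re] at h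
  linarith

omit [Fintype ι] in
lemma det_principal_neg (B : Matrix ι ι ℂ) (S : Finset ι) :
    (principal (-B) S).det = (-1) ^ S.card * (principal B S).det := by
  rw [show principal (-B) S = -principal B S from rfl, Matrix.det_neg, Fintype.card_coe]

theorem eta_smul_neg_ne_zero {A B : Matrix ι ι ℂ} (hA : A.PosDef) (hB : B.IsHermitian)
    {z : ℂ} (hz : 0 < z.im) : eta (z • A) (-B) ≠ 0 := by
  obtain ⟨ε, hε, hle⟩ := exists_pos_le_of_posDef hA
  -- Halving makes the bound `hM` strict.
  have hδ : 0 < z.im * ε / 2 := by positivity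
  have hM : ∀ v : ι → ℂ, v ≠ 0 → z.im * ε / 2 * ∑ i, Complex.normSq (v i) <
      (star v ⬝ᵥ (z • A).mulVec v).im := by
    intro v hv
    have him : (star v ⬝ᵥ A.mulVec v).im = 0 := by
      have := hA.1.im_star_dotProduct_mulVec_self v
      simpa using this
    have hpos : 0 < ∑ i, Complex.normSq (v i) := by
      obtain ⟨i, hi⟩ := Function.ne_iff.1 hv
      exact Finset.sum_pos' (fun i _ => Complex.normSq_nonneg _)
        ⟨i, Finset.mem_univ i, Complex.normSq_pos.2 hi⟩
    rw [Matrix.smul_mulVec, dotProduct_smul, smul_eq_mul, Complex.mul_im, him]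
    have h1 := mul_le_mul_of_nonneg_left (hle v) hz.le
    have h2 : 0 < z.im * ε * ∑ i, Complex.normSq (v i) := by positivity
    linarith
  have h := sum_contraction_ne_zero hδ (pencil 1 (z • A)) (pencil B 1)
    (fun u hu => pencil_one_ne_zero hM hu) (fun y hy => pencil_hermitian_ne_zero hB hy)
  convert h using 1
  -- The contraction indexes by the rows of `B`, `eta` by those of `A`; the signs become those of
  -- `det (-B)[S']`.
  refine Finset.sum_nbij' compl compl (by simp) (by simp) (by simp) (by simp) fun S _ => ?_
  have h1 := det_mixRows_one Sᶜ (z • A)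
  rw [compl_compl] at h1
  rw [pencil_piecewise, pencil_piecewise, h1, det_mixRows_one_right, det_principal_neg]
  ring

omit [Fintype ι] in
lemma conj_det_principal {A : Matrix ι ι ℂ} (hA : A.IsHermitian) (S : Finset ι) :
    conj (principal A S).det = (principal A S).det := by
  have h : (principal A S).IsHermitian := hA.submatrix _
  rw [← Complex.star_def, ← Matrix.det_conjTranspose, h.eq]

lemma conj_eta {A B : Matrix ι ι ℂ} (hA : A.IsHermitian) (hB : B.IsHermitian) (k : ℕ) :
    conj ((etaPoly A B).coeff k) = (etaPoly A B).coeff k := by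
  rw [coeff_etaPoly, map_sum]
  refine Finset.sum_congr rfl fun S _ => ?_
  rw [map_mul, conj_det_principal hA, conj_det_principal hB.neg]

theorem isHyperbolic_etaPoly {A B : Matrix ι ι ℂ} (hA : A.PosDef) (hB : B.IsHermitian) :
    IsHyperbolic (etaPoly A B) := by
  have hup : ∀ z : ℂ, 0 < z.im → (etaPoly A B).eval z ≠ 0 := fun z hz => by
    rw [eval_etaPoly]
    exact eta_smul_neg_ne_zero hA hB hz
  refine ⟨fun h => hup Complex.I (by simp) (by simp [h]),
    fun k => Complex.conj_eq_iff_im.1 (conj_eta hA.1 hB k), fun z hz => ?_⟩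
  rcases lt_trichotomy z.im 0 with h | h | h
  · refine absurd ?_ (hup (conj z) (by simpa using h))
    have h1 : (etaPoly A B).map (starRingEnd ℂ) = etaPoly A B := by
      ext1 k
      rw [Polynomial.coeff_map, conj_eta hA.1 hB]
    rw [← h1, Polynomial.eval_map_apply, hz.eq_zero, map_zero]
  · exact h
  · exact absurd hz (hup z h)

/-! ### Multiplicity of the root zero and the rank of `B`. -/

lemma det_principal_eq_zero {B : Matrix ι ι ℂ} {S : Finset ι} (h : B.rank < S.card) :
    (principal B S).det = 0 := by
  by_contra hne
  have h1 := Matrix.rank_of_det_ne_zero hne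
  have h2 : (principal B S).rank ≤ B.rank := Matrix.rank_submatrix_le _ _ _
  rw [h1, Fintype.card_coe] at h2
  omega

lemma apply_eq_sum_eigenvalues {B : Matrix ι ι ℂ} (hB : B.IsHermitian) (x y : ι) :
    B x y = ∑ i : {i // hB.eigenvalues i ≠ 0}, (hB.eigenvectorUnitary : Matrix ι ι ℂ) x i *
      hB.eigenvalues i * star ((hB.eigenvectorUnitary : Matrix ι ι ℂ) y i) := by
  have h := congrFun (congrFun hB.spectral_theorem x) y
  rw [Unitary.conjStarAlgAut_apply, Matrix.mul_apply] at h
  simp only [Matrix.mul_diagonal, Function.comp_apply] at h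
  rw [h]
  refine Eq.trans ?_ (Finset.sum_subtype (Finset.univ.filter fun i => hB.eigenvalues i ≠ 0)
    (by simp) (fun i => (hB.eigenvectorUnitary : Matrix ι ι ℂ) x i *
      hB.eigenvalues i * star ((hB.eigenvectorUnitary : Matrix ι ι ℂ) y i)))
  rw [Finset.sum_filter_of_ne]
  · rfl
  · intro i _ hi h0
    simp [h0] at hi

/-- All principal minors of a Hermitian matrix whose order is the rank are nonnegative multiples
of the product of the nonzero eigenvalues. -/
lemma exists_det_principal_eq {B : Matrix ι ι ℂ} (hB : B.IsHermitian) {S : Finset ι}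
    (h : S.card = B.rank) : ∃ x : ℝ, 0 ≤ x ∧ (principal B S).det =
      (∏ i : {i // hB.eigenvalues i ≠ 0}, (hB.eigenvalues i : ℂ)) * x := by
  have hcard : Fintype.card S = Fintype.card {i // hB.eigenvalues i ≠ 0} := by
    rw [Fintype.card_coe, h, hB.rank_eq_card_non_zero_eigs]
  let e := Fintype.equivOfCardEq hcard
  let V : Matrix S S ℂ := Matrix.of fun x i => (hB.eigenvectorUnitary : Matrix ι ι ℂ) x (e i)
  refine ⟨Complex.normSq V.det, Complex.normSq_nonneg _, ?_⟩
  -- Dropping null eigenvectors leaves exactly `|S| = rank B` columns, so `V` is square and the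
  -- determinant factors.
  have h1 : principal B S =
      V * Matrix.diagonal (fun i => (hB.eigenvalues (e i) : ℂ)) * V.conjTranspose := by
    ext x y
    rw [Matrix.mul_apply]
    simp only [Matrix.mul_diagonal, Matrix.conjTranspose_apply, principal, Matrix.submatrix_apply]
    rw [apply_eq_sum_eigenvalues hB, ← e.sum_comp]
    rfl
  rw [h1, Matrix.det_mul, Matrix.det_mul, Matrix.det_diagonal, Matrix.det_conjTranspose,
    ← e.prod_comp, ← Complex.mul_conj, Complex.star_def]
  ring

lemma coeff_etaPoly_eq_zero (A B : Matrix ι ι ℂ) {k : ℕ} (hk : k + B.rank < Fintype.card ι) :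
    (etaPoly A B).coeff k = 0 := by
  rw [coeff_etaPoly]
  refine Finset.sum_eq_zero fun S hS => ?_
  have hS' : S.card = k := (Finset.mem_filter.1 hS).2
  rw [det_principal_neg, det_principal_eq_zero (B := B), mul_zero, mul_zero]
  rw [Finset.card_compl]
  omega

lemma card_eigenvalues_eq_zero {B : Matrix ι ι ℂ} (hB : B.IsHermitian) :
    Fintype.card {i : ι // hB.eigenvalues i = 0} = Fintype.card ι - B.rank := by
  have h1 := Fintype.card_subtype_compl (fun i => hB.eigenvalues i = 0)
  have h2 := Fintype.card_subtype_le (fun i => hB.eigenvalues i = 0)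
  have h3 := hB.rank_eq_card_non_zero_eigs
  simp only [ne_eq] at h3
  omega

lemma rootMultiplicity_charpoly {B : Matrix ι ι ℂ} (hB : B.IsHermitian) :
    B.charpoly.rootMultiplicity 0 = Fintype.card ι - B.rank := by
  rw [← card_eigenvalues_eq_zero hB, ← Polynomial.count_roots,
    hB.roots_charpoly_eq_eigenvalues, Multiset.count_map, Fintype.card_subtype]
  rw [Finset.card_def, Finset.filter_val]
  congr 1
  refine Multiset.filter_congr fun i _ => ?_
  rw [Function.comp_apply, eq_comm (a := (0 : ℂ)), RCLike.ofReal_eq_zero]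

/-- Otherwise one more coefficient of the characteristic polynomial would vanish, and 0 would have
multiplicity above `n - rank B`. -/
lemma exists_det_principal_ne_zero {B : Matrix ι ι ℂ} (hB : B.IsHermitian) :
    ∃ S : Finset ι, S.card = B.rank ∧ (principal B S).det ≠ 0 := by
  by_contra! hcon
  have hr : B.rank ≤ Fintype.card ι := B.rank_le_card_width
  have hdvd : (Polynomial.X : ℂ[X]) ^ (Fintype.card ι - B.rank + 1) ∣ B.charpoly := by
    rw [Polynomial.X_pow_dvd_iff, ← etaPoly_one]
    intro k hk
    rcases Nat.lt_succ_iff_lt_or_eq.1 hk with h | h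
    · exact coeff_etaPoly_eq_zero _ _ (by omega)
    · rw [coeff_etaPoly]
      refine Finset.sum_eq_zero fun S hS => ?_
      have hS' : S.card = k := (Finset.mem_filter.1 hS).2
      rw [det_principal_neg, hcon, mul_zero, mul_zero]
      rw [Finset.card_compl]
      omega
  have h1 := (Polynomial.le_rootMultiplicity_iff (p := B.charpoly) (a := 0)
    B.charpoly_monic.ne_zero).2 (by simpa using hdvd)
  rw [rootMultiplicity_charpoly hB] at h1
  omega

theorem rootMultiplicity_etaPoly {A B : Matrix ι ι ℂ} (hA : A.PosDef) (hB : B.IsHermitian) :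
    (etaPoly A B).rootMultiplicity 0 = Fintype.card ι - B.rank := by
  have hr : B.rank ≤ Fintype.card ι := B.rank_le_card_width
  have hne : (etaPoly A B).coeff (Fintype.card ι - B.rank) ≠ 0 := by
    rw [coeff_etaPoly]
    have hcard : ∀ S : Finset ι, S.card = Fintype.card ι - B.rank → Sᶜ.card = B.rank := by
      intro S hS
      rw [Finset.card_compl]
      omega
    set D : ℂ := ∏ i : {i // hB.eigenvalues i ≠ 0}, (hB.eigenvalues i : ℂ) with hD
    have hD0 : D ≠ 0 := Finset.prod_ne_zero_iff.2 fun i _ => Complex.ofReal_ne_zero.2 i.2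
    -- The value 0 for sets of the wrong size only makes `x` total.
    have hx : ∀ S : Finset ι, ∃ x : ℝ, 0 ≤ x ∧
        (S.card = Fintype.card ι - B.rank → (principal B Sᶜ).det = D * x) := by
      intro S
      by_cases hS : S.card = Fintype.card ι - B.rank
      · obtain ⟨x, hx, h⟩ := exists_det_principal_eq hB (hcard S hS)
        exact ⟨x, hx, fun _ => h⟩
      · exact ⟨0, le_rfl, fun h => absurd h hS⟩
    choose x hx0 hx using hx
    have hA0 : ∀ S : Finset ι, 0 < (principal A S).det := fun S =>
      (hA.submatrix Subtype.val_injective).det_pos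
    have hsum : ∑ S : Finset ι with S.card = Fintype.card ι - B.rank,
        (principal A S).det * (principal (-B) Sᶜ).det =
        (-1) ^ B.rank * D * ∑ S : Finset ι with S.card = Fintype.card ι - B.rank,
          (principal A S).det * (x S : ℂ) := by
      rw [Finset.mul_sum]
      refine Finset.sum_congr rfl fun S hS => ?_
      have hS' := (Finset.mem_filter.1 hS).2
      rw [det_principal_neg, hcard S hS', hx S hS']
      ring
    rw [hsum]
    -- With the common factor `(-1)^rank B * D` removed, the terms are nonnegative and one is
    -- positive, so nothing cancels.
    refine mul_ne_zero (mul_ne_zero (pow_ne_zero _ (by norm_num)) hD0) (ne_of_gt ?_)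
    obtain ⟨T, hT, hT0⟩ := exists_det_principal_ne_zero hB
    have hT' : Tᶜ.card = Fintype.card ι - B.rank := by rw [Finset.card_compl, hT]
    refine Finset.sum_pos' (fun S _ => mul_nonneg (hA0 S).le ?_)
      ⟨Tᶜ, Finset.mem_filter.2 ⟨Finset.mem_univ _, hT'⟩, mul_pos (hA0 _) ?_⟩
    · exact_mod_cast hx0 S
    · have h1 := hx Tᶜ hT'
      rw [compl_compl] at h1
      have h2 : x Tᶜ ≠ 0 := fun h => hT0 (by rw [h1, h]; simp)
      exact_mod_cast lt_of_le_of_ne (hx0 _) h2.symm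
  rw [Polynomial.rootMultiplicity_eq_natTrailingDegree']
  refine le_antisymm (Polynomial.natTrailingDegree_le_of_ne_zero hne) ?_
  refine Polynomial.le_natTrailingDegree (fun h => hne (by simp [h])) fun k hk => ?_
  exact coeff_etaPoly_eq_zero A B (by omega)

/-! ### Deformation of `A` to the identity, and the conclusion. -/

theorem polyInertia_etaPoly {A B : Matrix ι ι ℂ} (hA : A.PosDef) (hB : B.IsHermitian) :
    polyInertia (etaPoly A B) = polyInertia (etaPoly 1 B) := by
  set p : ℝ → ℂ[X] := fun t => etaPoly (((1 - t : ℝ) : ℂ) • A + (t : ℂ) • 1) B with hp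
  have hpos : ∀ t ∈ Set.Icc (0 : ℝ) 1,
      (((1 - t : ℝ) : ℂ) • A + (t : ℂ) • (1 : Matrix ι ι ℂ)).PosDef := by
    rintro t ⟨h0, h1⟩
    rcases h0.eq_or_lt with rfl | h0
    · simpa using hA
    · have h2 : (0 : ℂ) ≤ ((1 - t : ℝ) : ℂ) := by exact_mod_cast sub_nonneg.2 h1
      have h3 : (0 : ℂ) < (t : ℂ) := by exact_mod_cast h0
      exact Matrix.PosDef.posSemidef_add (hA.posSemidef.smul h2) (Matrix.PosDef.one.smul h3)
  have h := polyInertia_eq_of_path (n := Fintype.card ι) (m := Fintype.card ι - B.rank) (p := p)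
    (fun t => natDegree_etaPoly_le _ _)
    (fun k => by
      simp only [hp, coeff_etaPoly]
      refine continuous_finsetSum _ fun S _ => Continuous.mul ?_ continuous_const
      refine Continuous.matrix_det (Continuous.matrix_submatrix ?_ _ _)
      fun_prop)
    (fun t ht => by
      simp only [hp, coeff_etaPoly_card]
      exact (hpos t ht).det_pos.ne')
    (fun t ht => (isHyperbolic_etaPoly (hpos t ht) hB).2.2)
    (fun t ht => rootMultiplicity_etaPoly (hpos t ht) hB)
  simpa [hp] using h

lemma polyInertia_charpoly {B : Matrix ι ι ℂ} (hB : B.IsHermitian) :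
    polyInertia B.charpoly = matrixInertia hB := by
  unfold polyInertia matrixInertia
  rw [hB.roots_charpoly_eq_eigenvalues]
  simp only [Multiset.countP_map, Function.comp_apply, Complex.coe_algebraMap,
    Complex.ofReal_im, Complex.ofReal_re, true_and,
    Complex.ofReal_eq_zero, Fintype.card_subtype]
  rfl

lemma polyInertia_etaPoly_zero {A B : Matrix ι ι ℂ} (hA : A.PosDef) (hB : B.IsHermitian) :
    (polyInertia (etaPoly A B)).2.1 = Module.finrank ℂ (LinearMap.ker (Matrix.toLin' B)) := by
  have h1 := (Matrix.toLin' B).finrank_range_add_finrank_ker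
  have h2 : Module.finrank ℂ (LinearMap.range (Matrix.toLin' B)) = B.rank := rfl
  rw [h2, Module.finrank_fintype_fun_eq_card] at h1
  rw [polyInertia_etaPoly hA hB, etaPoly_one, polyInertia_charpoly hB]
  have h3 := card_eigenvalues_eq_zero hB
  have h4 : (matrixInertia hB).2.1 = Fintype.card {i : ι // hB.eigenvalues i = 0} := by
    simp only [matrixInertia]
  omega

end MixedDet

theorem mainTheorem3 (n : ℕ) (A B : Matrix (Fin n) (Fin n) ℂ) (hA : A.PosDef)
    (hB : B.IsHermitian) :
    MixedDet.IsHyperbolic (MixedDet.etaPoly A B) ∧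
    MixedDet.polyInertia (MixedDet.etaPoly A B) = MixedDet.polyInertia (MixedDet.etaPoly 1 B) ∧
    MixedDet.etaPoly 1 B = B.charpoly ∧
    MixedDet.polyInertia B.charpoly = MixedDet.matrixInertia hB ∧
    (MixedDet.polyInertia (MixedDet.etaPoly A B)).2.1 =
      Module.finrank ℂ (LinearMap.ker (Matrix.toLin' B)) :=
  ⟨MixedDet.isHyperbolic_etaPoly hA hB, MixedDet.polyInertia_etaPoly hA hB,
    MixedDet.etaPoly_one B, MixedDet.polyInertia_charpoly hB,
    MixedDet.polyInertia_etaPoly_zero hA hB⟩
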